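/- Let $p(n)$ denote the number of partitions of the nonnegative integer $n$ (so $p(0)=1$), and let $$E_4 = 1 + 240\sum_{n\ge 1}\sigma_3(n)q^n,\qquad E_6 = 1 - 504\sum_{n\ge 1}\sigma_5(n)q^n,$$ where $\sigma_j(n)=\sum_{d\mid n,\ d>0}d^j$, be the $q$-expansions of the usual Eisenstein series of weights $4$ and $6$. Define integers $g(n)$ and $h(n)$ ($n\ge 0$) by $$\sum_{n=0}^{\infty} g(n)q^n = E_4E_6\prod_{n=1}^{\infty}(1-q^n),\qquad \sum_{n=0}^{\infty} h(n)q^n = E_4E_6\prod_{n=1}^{\infty}(1-q^n)^{23}.$$ Then for all integers $k,n\ge 0$ the arguments of $p$ below are integers, and $$p\left(\frac{23^{2k+1}(24n+1)+1}{24}\right)\equiv 5^k\, g(n)\pmod{23},\qquad p\left(\frac{23^{2k+2}(24n+23)+1}{24}\right)\equiv 5^{k+1}\,h(n)\pmod{23}.$$ In particular, for every integer $k\ge 0$, $$p\left(\frac{23^{2k+1}+1}{24}\right)\equiv 5^k\pmod{23}.$$ -/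

import Mathlib

open scoped PowerSeries PowerSeries.WithPiTopology

namespace PartitionMod23

/-- The number `p(n)` of partitions of `n`; in particular `p(0) = 1`. -/
def p (n : ℕ) : ℕ := Fintype.card (Nat.Partition n)

/-- The `q`-expansion `1 + 240 ∑_{n ≥ 1} σ₃(n) qⁿ` of the weight 4 Eisenstein series, with integer
coefficients (Mathlib's `σ₃(0)` is `0`). -/
noncomputable def E4 : ℤ⟦X⟧ :=
  1 + 240 * PowerSeries.mk fun n => (ArithmeticFunction.sigma 3 n : ℤ)

/-- The `q`-expansion `1 - 504 ∑_{n ≥ 1} σ₅(n) qⁿ` of the weight 6 Eisenstein series, with integer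
coefficients (Mathlib's `σ₅(0)` is `0`). -/
noncomputable def E6 : ℤ⟦X⟧ :=
  1 - 504 * PowerSeries.mk fun n => (ArithmeticFunction.sigma 5 n : ℤ)

/-- The infinite product `∏_{n ≥ 1} (1 - qⁿ)ʳ`, in the topology of coefficientwise convergence. -/
noncomputable def eulerProd (r : ℕ) : ℤ⟦X⟧ :=
  ∏' n : ℕ, (1 - PowerSeries.X ^ (n + 1)) ^ r

/-- `g(n)` is the coefficient of `qⁿ` in `E₄ E₆ ∏_{n ≥ 1} (1 - qⁿ)`. -/
noncomputable def g (n : ℕ) : ℤ := PowerSeries.coeff n (E4 * E6 * eulerProd 1)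

/-- `h(n)` is the coefficient of `qⁿ` in `E₄ E₆ ∏_{n ≥ 1} (1 - qⁿ)²³`. -/
noncomputable def h (n : ℕ) : ℤ := PowerSeries.coeff n (E4 * E6 * eulerProd 23)

/-- `E4` is the `q`-expansion of the modular form `E₄`. -/
theorem map_E4 :
    PowerSeries.map (Int.castRingHom ℂ) E4 =
      UpperHalfPlane.qExpansion 1 (ModularForm.E₄ : UpperHalfPlane → ℂ) := by
  have h240 : (240 : ℤ⟦X⟧) = PowerSeries.C 240 := (map_ofNat PowerSeries.C 240).symm
  ext m
  rw [EisensteinSeries.E_qExpansion_coeff _ ⟨2, rfl⟩,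
    show bernoulli 4 = -1 / 30 by decide +kernel, PowerSeries.coeff_map, E4, h240, map_add,
    PowerSeries.coeff_C_mul, PowerSeries.coeff_mk, PowerSeries.coeff_one]
  split_ifs with hm <;> norm_num [hm]

/-- `E6` is the `q`-expansion of the modular form `E₆`. -/
theorem map_E6 :
    PowerSeries.map (Int.castRingHom ℂ) E6 =
      UpperHalfPlane.qExpansion 1 (ModularForm.E₆ : UpperHalfPlane → ℂ) := by
  have h504 : (504 : ℤ⟦X⟧) = PowerSeries.C 504 := (map_ofNat PowerSeries.C 504).symm
  ext m
  rw [EisensteinSeries.E_qExpansion_coeff _ ⟨3, rfl⟩,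
    show bernoulli 6 = 1 / 42 by decide +kernel, PowerSeries.coeff_map, E6, h504, map_sub,
    PowerSeries.coeff_C_mul, PowerSeries.coeff_mk, PowerSeries.coeff_one]
  split_ifs with hm <;> norm_num [hm]

/-- The infinite product `eulerProd r` converges. -/
theorem hasProd_eulerProd (r : ℕ) :
    HasProd (fun n : ℕ => (1 - PowerSeries.X ^ (n + 1) : ℤ⟦X⟧) ^ r) (eulerProd r) :=
  ((PowerSeries.WithPiTopology.hasProd_one_sub_X_pow ℤ).multipliable.pow r).hasProd

end PartitionMod23

/-! Write E = ∏(1 - qⁿ), Δ = qE²⁴ and U for Atkin's operator at 23. Three congruences modulo 23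
suffice: p(23n + 1) ≡ g(n), g(23n + 22) ≡ 5 h(n) and h(23n) ≡ g(n). Substituting them into one
another replaces n by 23²n + 22, that is 24n + 1 by 23²(24n + 1), at the cost of a factor 5;
induction on k then gives the theorem.

The first two (`mk_p_eq`, `mk_g_eq`) identify U(Δ²²) with ΔE₄E₆ and show that ΔE₄E₆ is an
eigenvector of U with eigenvalue 5. Since U(F·H²³) = U(F)·H, powers of E pass through U and the
coefficients p(23n + 1), g(23n + 22) appear. The third holds because E₄E₆ = E₁₀ is fixed by U modulo
23.

The identities reduce to finitely many coefficients. By Fermat, F - θ²²F = U(F)²³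
(`sub_iterate_theta`). Modulo 23 one has E₂₂ ≡ 1 and E₂₄ ≡ E₂, so via the Serre derivative θ maps
modular forms modulo 23 of weight k to weight k + 24 (`IsModFormMod.theta`). Hence (U(F) - H)²³ is
itself a modular form modulo 23, and Sturm's bound (`IsModFormMod.eq_zero`) makes it vanish as soon
as a few coefficients of U(F) and H agree (`atkinU_eq_of_dvd`). -/

namespace PartitionMod23

/-! ### The operator q d/dq and the series E₂. -/

section Theta

variable {R S : Type*} [CommRing R] [CommRing S]

/-- The operator `q d/dq` on power series. -/
noncomputable def theta (F : R⟦X⟧) : R⟦X⟧ := PowerSeries.mk fun n => n * PowerSeries.coeff n F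

@[simp]
lemma coeff_theta (F : R⟦X⟧) (n : ℕ) :
    PowerSeries.coeff n (theta F) = n * PowerSeries.coeff n F :=
  PowerSeries.coeff_mk _ _

lemma map_theta (φ : R →+* S) (F : R⟦X⟧) :
    PowerSeries.map φ (theta F) = theta (PowerSeries.map φ F) := by
  ext n; simp

lemma coeff_iterate_theta (F : R⟦X⟧) (m n : ℕ) :
    PowerSeries.coeff n (theta^[m] F) = n ^ m * PowerSeries.coeff n F := by
  induction m with
  | zero => simp
  | succ m ih => rw [Function.iterate_succ_apply', coeff_theta, ih]; ring

/-- The `q`-expansion `1 - 24 ∑_{n ≥ 1} σ₁(n) qⁿ` of the quasimodular Eisenstein series of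
weight 2. -/
noncomputable def E2 : ℤ⟦X⟧ :=
  1 - 24 * PowerSeries.mk fun n => (ArithmeticFunction.sigma 1 n : ℤ)

lemma coeff_E2 (n : ℕ) : PowerSeries.coeff n E2 =
    if n = 0 then 1 else -24 * (ArithmeticFunction.sigma 1 n : ℤ) := by
  have h24 : (24 : ℤ⟦X⟧) = PowerSeries.C 24 := (map_ofNat PowerSeries.C 24).symm
  rw [E2, h24, map_sub, PowerSeries.coeff_C_mul, PowerSeries.coeff_mk, PowerSeries.coeff_one]
  split_ifs with hn <;> simp [hn]

end Theta

/-! ### q-expansions of E₂ and of Serre derivatives. -/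

section Analytic

open UpperHalfPlane hiding I
open Complex ModularForm Function Derivative
open scoped Real MatrixGroups Topology Manifold

/-- E₂, q and the Euler product are not level-one modular forms, so their periodicity and regularity
at the cusp have to be read off a convergent q-series. -/
lemma periodic_of_hasSum {f : ℍ → ℂ} {c : ℕ → ℂ}
    (hf : ∀ τ : ℍ, HasSum (fun m => c m • Periodic.qParam 1 τ ^ m) (f τ)) :
    Periodic (f ∘ ofComplex) (1 : ℝ) := by
  intro w
  by_cases! hw : 0 < im w
  · have hw' : 0 < im (w + (1 : ℝ)) := by simp [hw]
    simp only [comp_apply, ofComplex_apply_of_im_pos hw', ofComplex_apply_of_im_pos hw]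
    refine (hf ⟨_, hw'⟩).unique ?_
    have hq : Periodic.qParam 1 (w + (1 : ℝ)) = Periodic.qParam 1 w := by
      simp only [Periodic.qParam, ofReal_one, div_one, mul_add, mul_one, Complex.exp_add,
        Complex.exp_two_pi_mul_I]
    have h := hf ⟨w, hw⟩
    simp only [← hq] at h
    exact h
  · have : im (w + (1 : ℝ)) ≤ 0 := by simpa using hw
    simp only [comp_apply, ofComplex_apply_of_im_nonpos this, ofComplex_apply_of_im_nonpos hw]

lemma analyticAt_cuspFunction_of_hasSum {f : ℍ → ℂ} {c : ℕ → ℂ} (hol : MDiff f)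
    (hf : ∀ τ : ℍ, HasSum (fun m => c m • Periodic.qParam 1 τ ^ m) (f τ)) :
    AnalyticAt ℂ (cuspFunction 1 f) 0 :=
  analyticAt_cuspFunction_zero one_pos (periodic_of_hasSum hf) hol
    (isBoundedAtImInfty_of_hasSum_qExpansion one_pos hf)

lemma qExpansion_of_hasSum {f : ℍ → ℂ} {c : ℕ → ℂ} (hol : MDiff f)
    (hf : ∀ τ : ℍ, HasSum (fun m => c m • Periodic.qParam 1 τ ^ m) (f τ)) :
    qExpansion 1 f = PowerSeries.mk c := by
  ext m
  have han := analyticAt_cuspFunction_of_hasSum hol hf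
  have h1 := (hasFPowerSeriesOnBall_cuspFunction one_pos han hf).hasFPowerSeriesAt
  have h2 : HasFPowerSeriesAt (cuspFunction 1 f)
      (.ofScalars ℂ fun m => (qExpansion 1 f).coeff m) 0 := by
    simpa [qExpansion_coeff, div_eq_mul_inv, mul_comm] using han.hasFPowerSeriesAt
  simpa [FormalMultilinearSeries.coeff_ofScalars] using
    (congr_arg (FormalMultilinearSeries.coeff · m) (h1.eq_formalMultilinearSeries h2)).symm

lemma hasSum_E2 (τ : ℍ) : HasSum (fun m : ℕ =>
    (if m = 0 then 1 else -24 * ArithmeticFunction.sigma 1 m : ℂ) • Periodic.qParam 1 τ ^ m)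
    (EisensteinSeries.E2 τ) := by
  simpa only [Periodic.qParam, ofReal_one, div_one] using EisensteinSeries.hasSum_qExpansion_E2 τ

lemma map_E2 : PowerSeries.map (Int.castRingHom ℂ) E2 = qExpansion 1 EisensteinSeries.E2 := by
  rw [qExpansion_of_hasSum E2_mdifferentiable hasSum_E2]
  ext m
  rw [PowerSeries.coeff_map, coeff_E2, PowerSeries.coeff_mk]
  split_ifs <;> simp

/-- The normalized derivative acts on `q`-expansions as `q d/dq`. -/
lemma hasSum_normalizedDerivOfComplex {f : ℍ → ℂ} (hper : Periodic (f ∘ ofComplex) (1 : ℝ))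
    (hol : MDiff f) (hbdd : IsBoundedAtImInfty f) (τ : ℍ) :
    HasSum (fun m : ℕ => ((m : ℂ) * (qExpansion 1 f).coeff m) • Periodic.qParam 1 τ ^ m)
      (normalizedDerivOfComplex f τ) := by
  set φ := cuspFunction 1 f with hφ
  set q := Periodic.qParam 1 (τ : ℂ) with hq
  have hdiff : DifferentiableOn ℂ φ (Metric.ball 0 1) :=
    differentiableOn_cuspFunction_ball one_pos hper hol hbdd
  have hqn : q ∈ Metric.ball (0 : ℂ) 1 := by
    simpa using Periodic.norm_qParam_lt_one one_pos τ.im_pos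
  have hcomp : f ∘ ofComplex = fun z => φ (Periodic.qParam 1 z) :=
    funext fun z => (Periodic.eq_cuspFunction one_ne_zero hper z).symm
  have hqd : HasDerivAt (Periodic.qParam 1) (q * (2 * π * I)) τ := by
    have : HasDerivAt (fun z : ℂ => 2 * π * I * z / (1 : ℝ)) (2 * π * I) τ := by
      simpa using (hasDerivAt_id (τ : ℂ)).const_mul (2 * π * I)
    exact this.cexp
  have hval : normalizedDerivOfComplex f τ = q * deriv φ q := by
    have hd := ((hdiff.differentiableAt (Metric.isOpen_ball.mem_nhds hqn)).hasDerivAt).comp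
      (τ : ℂ) hqd
    rw [normalizedDerivOfComplex, hcomp, show (fun z => φ (Periodic.qParam 1 z)) =
      φ ∘ Periodic.qParam 1 from rfl, hd.deriv]
    have := two_pi_I_ne_zero
    field_simp
  have hS := hasSum_taylorSeries_on_ball (hdiff.deriv Metric.isOpen_ball) hqn
  -- The term m = 0 vanishes, which matches the factor q in front of the Taylor series of `deriv φ`.
  rw [hval, ← hasSum_nat_add_iff' 1]
  simp only [Finset.range_one, Finset.sum_singleton, Nat.cast_zero, zero_mul, zero_smul, sub_zero]
  convert! hS.mul_left q using 2 with n
  rw [qExpansion_coeff, iteratedDeriv_succ', Nat.factorial_succ]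
  have h1 : ((n : ℂ) + 1) ≠ 0 := by exact_mod_cast n.succ_ne_zero
  have h2 : (n.factorial : ℂ) ≠ 0 := by exact_mod_cast n.factorial_ne_zero
  simp only [smul_eq_mul, sub_zero]
  push_cast
  field_simp
  ring

variable {k : ℤ}

/-- The Serre derivative of a modular form of level one. -/
noncomputable def serreForm (f : ModularForm 𝒮ℒ k) : ModularForm 𝒮ℒ (k + 2) where
  toFun := serreDerivative k f
  slash_action_eq' := by
    rintro _ ⟨γ, rfl⟩
    exact serreDerivative_slash_invariant f.holo' (f.slash_action_eq' _ ⟨γ, rfl⟩)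
  holo' := serreDerivative_mdifferentiable k f.holo'
  bdd_at_cusps' {c} hc := by
    rw [Subgroup.IsArithmetic.isCusp_iff_isCusp_SL2Z] at hc
    rw [OnePoint.isBoundedAt_iff_forall_SL2Z hc]
    intro γ _
    have hinv : serreDerivative k f ∣[k + 2] γ = serreDerivative k f :=
      serreDerivative_slash_invariant f.holo' (f.slash_action_eq' _ ⟨γ, rfl⟩)
    rw [hinv]
    have hb : IsBoundedAtImInfty f := ModularFormClass.bdd_at_infty f
    have hD : IsBoundedAtImInfty (normalizedDerivOfComplex f) :=
      isBoundedAtImInfty_of_hasSum_qExpansion one_pos (hasSum_normalizedDerivOfComplex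
        (SlashInvariantFormClass.periodic_comp_ofComplex f one_mem_strictPeriods_SL) f.holo' hb)
    have hc : IsBoundedAtImInfty (fun _ : ℍ => (k : ℂ) * 12⁻¹) :=
      Filter.const_boundedAtFilter _ _
    exact hD.sub ((hc.mul EisensteinSeries.isBoundedAtImInfty_E2).mul hb)

lemma qExpansion_serreForm (f : ModularForm 𝒮ℒ k) :
    qExpansion 1 (serreForm f) = theta (qExpansion 1 f) -
      PowerSeries.C ((k : ℂ) * 12⁻¹) * (qExpansion 1 EisensteinSeries.E2 * qExpansion 1 f) := by
  have hDs := hasSum_normalizedDerivOfComplex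
    (SlashInvariantFormClass.periodic_comp_ofComplex f one_mem_strictPeriods_SL) f.holo'
    (ModularFormClass.bdd_at_infty f)
  have hDm : MDiff (normalizedDerivOfComplex f) :=
    normalizedDerivOfComplex_mdifferentiable f.holo'
  have hD := analyticAt_cuspFunction_of_hasSum hDm hDs
  have hE := analyticAt_cuspFunction_of_hasSum E2_mdifferentiable hasSum_E2
  have hf := ModularFormClass.analyticAt_cuspFunction_zero f one_pos one_mem_strictPeriods_SL
  have hEf : AnalyticAt ℂ (cuspFunction 1 (EisensteinSeries.E2 * f)) 0 := by
    rw [cuspFunction_mul hE.continuousAt hf.continuousAt]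
    exact hE.mul hf
  have hcEf : AnalyticAt ℂ (cuspFunction 1 (((k : ℂ) * 12⁻¹) • (EisensteinSeries.E2 * f))) 0 := by
    rw [cuspFunction_smul hEf.continuousAt]
    exact hEf.const_smul
  have hfun : (serreForm f : ℍ → ℂ) = normalizedDerivOfComplex f -
      ((k : ℂ) * 12⁻¹) • (EisensteinSeries.E2 * (f : ℍ → ℂ)) := by
    ext z
    change serreDerivative k f z = _
    simp [mul_assoc]
  rw [hfun, qExpansion_sub hD hcEf, qExpansion_smul hEf, qExpansion_mul hE hf,
    PowerSeries.smul_eq_C_mul, qExpansion_of_hasSum hDm hDs]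
  rfl

end Analytic

/-! ### The formal Euler product and the discriminant. -/

section EulerProduct

open UpperHalfPlane hiding I
open Complex ModularForm Function
open scoped Real MatrixGroups Topology Manifold

lemma eulerProd_eq_pow (r : ℕ) : eulerProd r = PowerSeries.pentagonalSeries ℤ ^ r :=
  ((PowerSeries.WithPiTopology.hasProd_one_sub_X_pow ℤ).pow r).tprod_eq

lemma map_pentagonalSeries {R S : Type*} [CommRing R] [CommRing S] (φ : R →+* S) :
    PowerSeries.map φ (PowerSeries.pentagonalSeries R) = PowerSeries.pentagonalSeries S := by
  ext n
  rw [PowerSeries.coeff_map, PowerSeries.pentagonalSeries, PowerSeries.pentagonalSeries,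
    PowerSeries.coeff_mk, PowerSeries.coeff_mk]
  split_ifs <;> simp

lemma tendstoLocallyUniformlyOn_iterate_deriv {ι : Type*} {p : Filter ι} [p.NeBot]
    {F : ι → ℂ → ℂ} {f : ℂ → ℂ} {U : Set ℂ} (hU : IsOpen U)
    (hf : TendstoLocallyUniformlyOn F f p U) (hF : ∀ n, DifferentiableOn ℂ (F n) U) (m : ℕ) :
    TendstoLocallyUniformlyOn (fun n => deriv^[m] (F n)) (deriv^[m] f) p U ∧
      ∀ n, DifferentiableOn ℂ (deriv^[m] (F n)) U := by
  induction m with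
  | zero => exact ⟨hf, hF⟩
  | succ m ih =>
    simp only [Function.iterate_succ_apply']
    exact ⟨ih.1.deriv (Filter.Eventually.of_forall ih.2) hU, fun n => (ih.2 n).deriv hU⟩

lemma iterate_deriv_polynomial_eval (P : Polynomial ℂ) (m : ℕ) :
    deriv^[m] (fun q => P.eval q) = fun q => (Polynomial.derivative^[m] P).eval q := by
  induction m with
  | zero => rfl
  | succ m ih =>
    rw [Function.iterate_succ_apply', ih, Function.iterate_succ_apply']
    ext q
    exact Polynomial.deriv _

/-- Locally uniform convergence lets derivatives pass to the limit of the partial products, whose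
m-th coefficient is eventually constant. This links the analytic product to the formal one. -/
lemma iterate_deriv_tprod_one_sub_pow (m : ℕ) :
    deriv^[m] (fun q : ℂ => ∏' n, (1 - q ^ (n + 1))) 0 =
      m.factorial * PowerSeries.coeff m (PowerSeries.pentagonalSeries ℂ) := by
  have hlim := multipliableLocallyUniformlyOn_one_sub_pow.hasProdLocallyUniformlyOn
  rw [hasProdLocallyUniformlyOn_iff_tendstoLocallyUniformlyOn] at hlim
  have h0 := ((tendstoLocallyUniformlyOn_iterate_deriv Metric.isOpen_ball hlim
    (fun s => by fun_prop) m).1).tendsto_at (Metric.mem_ball_self one_pos)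
  refine tendsto_nhds_unique h0 (tendsto_nhds_of_eventually_eq ?_)
  filter_upwards [PowerSeries.coeff_prod_one_sub_X_pow_eventually_eq ℂ m] with s hs
  have hpoly : (fun q : ℂ => ∏ n ∈ s, (1 - q ^ (n + 1))) =
      fun q => (∏ n ∈ s, (1 - Polynomial.X ^ (n + 1)) : Polynomial ℂ).eval q := by
    ext q
    simp [Polynomial.eval_prod]
  have hcoe : (∏ n ∈ s, (1 - PowerSeries.X ^ (n + 1)) : ℂ⟦X⟧) =
      ((∏ n ∈ s, (1 - Polynomial.X ^ (n + 1)) : Polynomial ℂ) : ℂ⟦X⟧) := by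
    rw [← Polynomial.coeToPowerSeries.ringHom_apply, map_prod]
    simp
  rw [hpoly, iterate_deriv_polynomial_eval]
  beta_reduce
  rw [← Polynomial.coeff_zero_eq_eval_zero,
    Polynomial.coeff_iterate_derivative, ← hs, hcoe, Polynomial.coeff_coe]
  simp [Nat.descFactorial_self]

/-- The function `τ ↦ ∏_{n ≥ 1} (1 - qⁿ)` on the upper half plane. -/
noncomputable def eulerFun (τ : ℍ) : ℂ := ∏' n, (1 - Periodic.qParam 1 (τ : ℂ) ^ (n + 1))

lemma mdifferentiable_eulerFun : MDiff eulerFun := by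
  rw [UpperHalfPlane.mdifferentiable_iff]
  have hmaps : Set.MapsTo (Periodic.qParam 1) {z : ℂ | 0 < z.im} (Metric.ball 0 1) :=
    fun z hz => by simpa using Periodic.norm_qParam_lt_one one_pos hz
  refine (differentiableOn_tprod_one_sub_pow.comp
    Periodic.differentiable_qParam.differentiableOn hmaps).congr fun z hz => ?_
  simp only [comp_apply, eulerFun, ofComplex_apply_of_im_pos hz]

lemma hasSum_eulerFun (τ : ℍ) : HasSum (fun m =>
    PowerSeries.coeff m (PowerSeries.pentagonalSeries ℂ) • Periodic.qParam 1 τ ^ m)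
    (eulerFun τ) := by
  have hqn : Periodic.qParam 1 (τ : ℂ) ∈ Metric.ball (0 : ℂ) 1 := by
    simpa using Periodic.norm_qParam_lt_one one_pos τ.im_pos
  convert! hasSum_taylorSeries_on_ball differentiableOn_tprod_one_sub_pow hqn using 2 with m
  rw [iteratedDeriv_eq_iterate, iterate_deriv_tprod_one_sub_pow]
  have h2 : (m.factorial : ℂ) ≠ 0 := by exact_mod_cast m.factorial_ne_zero
  simp only [smul_eq_mul, sub_zero]
  field_simp

lemma mdifferentiable_qParam : MDiff (fun τ : ℍ => Periodic.qParam 1 (τ : ℂ)) := by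
  rw [UpperHalfPlane.mdifferentiable_iff]
  refine (Periodic.differentiable_qParam (h := 1)).differentiableOn.congr fun z hz => ?_
  simp only [comp_apply, ofComplex_apply_of_im_pos hz]

lemma hasSum_qParam (τ : ℍ) : HasSum (fun m : ℕ =>
    PowerSeries.coeff m (PowerSeries.X : ℂ⟦X⟧) • Periodic.qParam 1 τ ^ m)
    (Periodic.qParam 1 (τ : ℂ)) := by
  convert! hasSum_single (f := fun m : ℕ =>
    PowerSeries.coeff m (PowerSeries.X : ℂ⟦X⟧) • Periodic.qParam 1 (τ : ℂ) ^ m) 1 ?_ using 1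
  · simp
  · intro m hm
    simp [PowerSeries.coeff_X, hm]

lemma qExpansion_pow_of_analyticAt {f : ℍ → ℂ} (hf : AnalyticAt ℂ (cuspFunction 1 f) 0) (n : ℕ) :
    qExpansion 1 (f ^ n) = qExpansion 1 f ^ n ∧ AnalyticAt ℂ (cuspFunction 1 (f ^ n)) 0 := by
  induction n with
  | zero =>
    refine ⟨by simp [qExpansion_one], ?_⟩
    rw [pow_zero]
    refine analyticAt_cuspFunction_of_hasSum (c := fun m => if m = 0 then 1 else 0)
      mdifferentiable_const fun τ => ?_
    convert! hasSum_ite_eq (0 : ℕ) (1 : ℂ) using 2 with m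
    split_ifs with hm <;> simp [hm]
  | succ n ih =>
    refine ⟨by rw [pow_succ, qExpansion_mul ih.2 hf, ih.1, pow_succ], ?_⟩
    rw [pow_succ, cuspFunction_mul ih.2.continuousAt hf.continuousAt]
    exact ih.2.mul hf

lemma map_X_mul_eulerProd :
    PowerSeries.map (Int.castRingHom ℂ) (PowerSeries.X * eulerProd 24) =
      qExpansion 1 ModularForm.discriminant := by
  have hfun : ModularForm.discriminant =
      (fun τ : ℍ => Periodic.qParam 1 (τ : ℂ)) * eulerFun ^ 24 := by
    ext z
    rw [discriminant_eq_q_prod, Pi.mul_apply, Pi.pow_apply, eulerFun]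
    congr 1
    have hm := multipliable_one_sub_pow (Periodic.norm_qParam_lt_one one_pos z.im_pos)
    rw [← hm.tprod_pow]
  have hq := analyticAt_cuspFunction_of_hasSum mdifferentiable_qParam hasSum_qParam
  have he := analyticAt_cuspFunction_of_hasSum mdifferentiable_eulerFun hasSum_eulerFun
  obtain ⟨hpow, hpowa⟩ := qExpansion_pow_of_analyticAt he 24
  have hX := qExpansion_of_hasSum mdifferentiable_qParam hasSum_qParam
  have hP := qExpansion_of_hasSum mdifferentiable_eulerFun hasSum_eulerFun
  have hmk (F : ℂ⟦X⟧) : PowerSeries.mk (fun m => PowerSeries.coeff m F) = F := by ext; simp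
  rw [hmk] at hX hP
  rw [hfun, qExpansion_mul hq hpowa, hpow, hX, hP, eulerProd_eq_pow, map_mul, map_pow,
    map_pentagonalSeries, PowerSeries.map_X]

end EulerProduct

/-! ### Bernoulli numbers up to index 24. -/

section Bernoulli

lemma bernoulli_eq_of_sum {n : ℕ} (hn0 : n ≠ 0) {b : ℚ}
    (h : ∑ k ∈ Finset.range n, ((n + 1).choose k : ℚ) * bernoulli k + (n + 1) * b = 0) :
    bernoulli n = b := by
  have hs := sum_bernoulli (n + 1)
  rw [if_neg (by omega), Finset.sum_range_succ, Nat.choose_succ_self_right] at hs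
  have hne : (n : ℚ) + 1 ≠ 0 := by positivity
  refine mul_left_cancel₀ hne ?_
  push_cast at hs
  linear_combination hs - h

/-- In the usual recursion the only nonzero term of odd index is that of B₁ = -1/2, which
contributes -(2m + 1)/2. -/
lemma bernoulli_eq_of_sum_even {m : ℕ} (hm : m ≠ 0) {b : ℚ}
    (h : ∑ k ∈ Finset.range m, ((2 * m + 1).choose (2 * k) : ℚ) * bernoulli (2 * k) -
      (2 * m + 1) / 2 + (2 * m + 1) * b = 0) :
    bernoulli (2 * m) = b := by
  refine bernoulli_eq_of_sum (by omega) ?_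
  obtain ⟨m, rfl⟩ := Nat.exists_eq_succ_of_ne_zero hm
  have hodd : ∀ j : ℕ, ∑ k ∈ Finset.range (2 * (j + 1)),
      ((2 * (m + 1) + 1).choose k : ℚ) * bernoulli k =
      ∑ k ∈ Finset.range (j + 1), ((2 * (m + 1) + 1).choose (2 * k) : ℚ) * bernoulli (2 * k) -
        (2 * (m + 1) + 1) / 2 := by
    intro j
    induction j with
    | zero => simp [Finset.sum_range_succ]; ring
    | succ j ih =>
      rw [show 2 * (j + 1 + 1) = 2 * (j + 1) + 1 + 1 by ring, Finset.sum_range_succ,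
        Finset.sum_range_succ, ih, Finset.sum_range_succ _ (j + 1),
        bernoulli_eq_zero_of_odd (n := 2 * (j + 1) + 1) ⟨j + 1, rfl⟩ (by omega)]
      ring
  rw [hodd m]
  push_cast at h ⊢
  linear_combination h

lemma bernoulli_four : bernoulli 4 = -1/30 :=
  bernoulli_eq_of_sum_even (m := 2) (by norm_num) (by
    norm_num [Finset.sum_range_succ, Nat.choose_eq_descFactorial_div_factorial,
      Nat.descFactorial, Nat.factorial, bernoulli_zero, bernoulli_two])

lemma bernoulli_six : bernoulli 6 = 1/42 :=
  bernoulli_eq_of_sum_even (m := 3) (by norm_num) (by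
    norm_num [Finset.sum_range_succ, Nat.choose_eq_descFactorial_div_factorial,
      Nat.descFactorial, Nat.factorial, bernoulli_zero, bernoulli_two, bernoulli_four])

lemma bernoulli_eight : bernoulli 8 = -1/30 :=
  bernoulli_eq_of_sum_even (m := 4) (by norm_num) (by
    norm_num [Finset.sum_range_succ, Nat.choose_eq_descFactorial_div_factorial,
      Nat.descFactorial, Nat.factorial, bernoulli_zero, bernoulli_two, bernoulli_four,
      bernoulli_six])

lemma bernoulli_ten : bernoulli 10 = 5/66 :=
  bernoulli_eq_of_sum_even (m := 5) (by norm_num) (by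
    norm_num [Finset.sum_range_succ, Nat.choose_eq_descFactorial_div_factorial,
      Nat.descFactorial, Nat.factorial, bernoulli_zero, bernoulli_two, bernoulli_four,
      bernoulli_six, bernoulli_eight])

lemma bernoulli_twelve : bernoulli 12 = -691/2730 :=
  bernoulli_eq_of_sum_even (m := 6) (by norm_num) (by
    norm_num [Finset.sum_range_succ, Nat.choose_eq_descFactorial_div_factorial,
      Nat.descFactorial, Nat.factorial, bernoulli_zero, bernoulli_two, bernoulli_four,
      bernoulli_six, bernoulli_eight, bernoulli_ten])

lemma bernoulli_fourteen : bernoulli 14 = 7/6 :=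
  bernoulli_eq_of_sum_even (m := 7) (by norm_num) (by
    norm_num [Finset.sum_range_succ, Nat.choose_eq_descFactorial_div_factorial,
      Nat.descFactorial, Nat.factorial, bernoulli_zero, bernoulli_two, bernoulli_four,
      bernoulli_six, bernoulli_eight, bernoulli_ten, bernoulli_twelve])

lemma bernoulli_sixteen : bernoulli 16 = -3617/510 :=
  bernoulli_eq_of_sum_even (m := 8) (by norm_num) (by
    norm_num [Finset.sum_range_succ, Nat.choose_eq_descFactorial_div_factorial,
      Nat.descFactorial, Nat.factorial, bernoulli_zero, bernoulli_two, bernoulli_four,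
      bernoulli_six, bernoulli_eight, bernoulli_ten, bernoulli_twelve, bernoulli_fourteen])

lemma bernoulli_eighteen : bernoulli 18 = 43867/798 :=
  bernoulli_eq_of_sum_even (m := 9) (by norm_num) (by
    norm_num [Finset.sum_range_succ, Nat.choose_eq_descFactorial_div_factorial,
      Nat.descFactorial, Nat.factorial, bernoulli_zero, bernoulli_two, bernoulli_four,
      bernoulli_six, bernoulli_eight, bernoulli_ten, bernoulli_twelve, bernoulli_fourteen,
      bernoulli_sixteen])

lemma bernoulli_twenty : bernoulli 20 = -174611/330 :=
  bernoulli_eq_of_sum_even (m := 10) (by norm_num) (by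
    norm_num [Finset.sum_range_succ, Nat.choose_eq_descFactorial_div_factorial,
      Nat.descFactorial, Nat.factorial, bernoulli_zero, bernoulli_two, bernoulli_four,
      bernoulli_six, bernoulli_eight, bernoulli_ten, bernoulli_twelve, bernoulli_fourteen,
      bernoulli_sixteen, bernoulli_eighteen])

lemma bernoulli_twentyTwo : bernoulli 22 = 854513/138 :=
  bernoulli_eq_of_sum_even (m := 11) (by norm_num) (by
    norm_num [Finset.sum_range_succ, Nat.choose_eq_descFactorial_div_factorial,
      Nat.descFactorial, Nat.factorial, bernoulli_zero, bernoulli_two, bernoulli_four,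
      bernoulli_six, bernoulli_eight, bernoulli_ten, bernoulli_twelve, bernoulli_fourteen,
      bernoulli_sixteen, bernoulli_eighteen, bernoulli_twenty])

lemma bernoulli_twentyFour : bernoulli 24 = -236364091/2730 :=
  bernoulli_eq_of_sum_even (m := 12) (by norm_num) (by
    norm_num [Finset.sum_range_succ, Nat.choose_eq_descFactorial_div_factorial,
      Nat.descFactorial, Nat.factorial, bernoulli_zero, bernoulli_two, bernoulli_four,
      bernoulli_six, bernoulli_eight, bernoulli_ten, bernoulli_twelve, bernoulli_fourteen,
      bernoulli_sixteen, bernoulli_eighteen, bernoulli_twenty, bernoulli_twentyTwo])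

end Bernoulli

/-! ### Modular forms modulo p and Sturm's bound. -/

section ModularFormsModP

open UpperHalfPlane hiding I
open ModularForm
open scoped MatrixGroups

/-- Reduction of the coefficients of an integral power series modulo `p`. -/
noncomputable abbrev reduce (p : ℕ) : ℤ⟦X⟧ →+* (ZMod p)⟦X⟧ :=
  PowerSeries.map (Int.castRingHom (ZMod p))

/-- `F` is the reduction modulo `p` of the `q`-expansion of a modular form of weight `k` and
level one with integral Fourier coefficients. -/
def IsModFormMod (p : ℕ) (k : ℤ) (F : (ZMod p)⟦X⟧) : Prop :=
  ∃ (G : ℤ⟦X⟧) (f : ModularForm 𝒮ℒ k),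
    PowerSeries.map (Int.castRingHom ℂ) G = qExpansion 1 f ∧ reduce p G = F

variable {p : ℕ} {k l : ℤ} {F H : (ZMod p)⟦X⟧}

lemma isModFormMod_reduce {G : ℤ⟦X⟧} {f : ModularForm 𝒮ℒ k}
    (h : PowerSeries.map (Int.castRingHom ℂ) G = qExpansion 1 f) :
    IsModFormMod p k (reduce p G) :=
  ⟨G, f, h, rfl⟩

lemma IsModFormMod.congr_weight (hF : IsModFormMod p k F) (h : k = l) : IsModFormMod p l F :=
  h ▸ hF

lemma IsModFormMod.add (hF : IsModFormMod p k F) (hH : IsModFormMod p k H) :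
    IsModFormMod p k (F + H) := by
  obtain ⟨G, f, hG, rfl⟩ := hF
  obtain ⟨G', f', hG', rfl⟩ := hH
  refine ⟨G + G', f + f', ?_, map_add _ _ _⟩
  rw [FunLike.coe_add, ModularForm.qExpansion_add one_pos one_mem_strictPeriods_SL, map_add, hG,
    hG']

lemma IsModFormMod.sub (hF : IsModFormMod p k F) (hH : IsModFormMod p k H) :
    IsModFormMod p k (F - H) := by
  obtain ⟨G, f, hG, rfl⟩ := hF
  obtain ⟨G', f', hG', rfl⟩ := hH
  refine ⟨G - G', f - f', ?_, map_sub _ _ _⟩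
  rw [FunLike.coe_sub, ModularForm.qExpansion_sub one_pos one_mem_strictPeriods_SL, map_sub, hG,
    hG']

lemma map_C_mul_eq_qExpansion {G : ℤ⟦X⟧} {f : ModularForm 𝒮ℒ k} (c : ℤ)
    (h : PowerSeries.map (Int.castRingHom ℂ) G = qExpansion 1 f) :
    PowerSeries.map (Int.castRingHom ℂ) (PowerSeries.C c * G) =
      qExpansion 1 ((c : ℂ) • f : ModularForm 𝒮ℒ k) := by
  rw [FunLike.coe_smul, ModularForm.qExpansion_smul one_pos one_mem_strictPeriods_SL, map_mul, h,
    PowerSeries.map_C, PowerSeries.smul_eq_C_mul]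
  simp

lemma IsModFormMod.C_mul (hF : IsModFormMod p k F) (c : ZMod p) :
    IsModFormMod p k (PowerSeries.C c * F) := by
  obtain ⟨G, f, hG, rfl⟩ := hF
  obtain ⟨c, rfl⟩ := ZMod.intCast_surjective c
  refine ⟨_, _, map_C_mul_eq_qExpansion c hG, ?_⟩
  simp [reduce]

lemma IsModFormMod.mul (hF : IsModFormMod p k F) (hH : IsModFormMod p l H) :
    IsModFormMod p (k + l) (F * H) := by
  obtain ⟨G, f, hG, rfl⟩ := hF
  obtain ⟨G', f', hG', rfl⟩ := hH
  refine ⟨G * G', f.mul f', ?_, map_mul _ _ _⟩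
  rw [ModularForm.qExpansion_mul one_pos one_mem_strictPeriods_SL, map_mul, hG, hG']

lemma IsModFormMod.pow (hF : IsModFormMod p k F) (n : ℕ) : IsModFormMod p (n * k) (F ^ n) := by
  obtain ⟨G, f, hG, rfl⟩ := hF
  refine ⟨G ^ n, f.pow n, ?_, map_pow _ _ _⟩
  rw [ModularForm.qExpansion_pow one_pos one_mem_strictPeriods_SL, map_pow, hG]

lemma isModFormMod_discriminant :
    IsModFormMod p 12 (reduce p (PowerSeries.X * eulerProd 24)) := by
  let Δ : ModularForm 𝒮ℒ 12 := CuspForm.toModularFormₗ CuspForm.discriminant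
  exact isModFormMod_reduce (f := Δ) map_X_mul_eulerProd

lemma isModFormMod_eisenstein {k : ℕ} (hk : 3 ≤ k) (hk2 : Even k) {N D : ℤ} (hN : N ≠ 0)
    (h : 2 * k / bernoulli k = D / N) :
    IsModFormMod p k (reduce p (PowerSeries.C N -
      PowerSeries.C D * PowerSeries.mk fun n => (ArithmeticFunction.sigma (k - 1) n : ℤ))) := by
  refine isModFormMod_reduce (f := (N : ℂ) • (E hk : ModularForm 𝒮ℒ k)) ?_
  rw [FunLike.coe_smul, ModularForm.qExpansion_smul one_pos one_mem_strictPeriods_SL]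
  have hc : (2 * k / bernoulli k : ℂ) = D / N := by exact_mod_cast congrArg (Rat.cast : ℚ → ℂ) h
  have hN' : (N : ℂ) ≠ 0 := by exact_mod_cast hN
  ext m
  rw [PowerSeries.coeff_map, PowerSeries.coeff_smul, EisensteinSeries.E_qExpansion_coeff hk hk2, hc,
    map_sub, PowerSeries.coeff_C_mul, PowerSeries.coeff_mk, PowerSeries.coeff_C]
  split_ifs with hm
  · simp [hm]
  · simp
    field_simp

/-- The factor 12 clears the denominator of the Serre derivative θf - (k/12)E₂f, keeping the
coefficients integral. -/
lemma IsModFormMod.serre (hF : IsModFormMod p k F) :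
    IsModFormMod p (k + 2)
      (PowerSeries.C 12 * theta F - PowerSeries.C (k : ZMod p) * (reduce p E2 * F)) := by
  obtain ⟨G, f, hG, rfl⟩ := hF
  refine ⟨PowerSeries.C 12 * theta G - PowerSeries.C k * (E2 * G), (12 : ℂ) • serreForm f, ?_, ?_⟩
  · have h12 : (PowerSeries.C 12 : ℂ⟦X⟧) * PowerSeries.C 12⁻¹ = 1 := by
      rw [← map_mul, mul_inv_cancel₀ (by norm_num), map_one]
    rw [FunLike.coe_smul, ModularForm.qExpansion_smul one_pos one_mem_strictPeriods_SL,
      qExpansion_serreForm, ← hG, ← map_E2, PowerSeries.smul_eq_C_mul]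
    simp only [map_sub, map_mul, PowerSeries.map_C, Int.coe_castRingHom, Int.cast_ofNat, map_theta]
    linear_combination (PowerSeries.C (k : ℂ) * PowerSeries.map (Int.castRingHom ℂ) E2 *
      PowerSeries.map (Int.castRingHom ℂ) G) * h12
  · simp only [map_sub, map_mul, PowerSeries.map_C, Int.coe_castRingHom, Int.cast_ofNat, map_theta]

lemma exists_eulerProd_mul_eq_one (r : ℕ) : ∃ V, eulerProd r * V = 1 := by
  refine IsUnit.exists_right_inv (PowerSeries.isUnit_iff_constantCoeff.mpr ?_)
  have h := PowerSeries.coeff_pentagonalSeries_pentagonal ℤ 0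
  rw [show pentagonal 0 = 0 by decide, PowerSeries.coeff_zero_eq_constantCoeff_apply] at h
  rw [eulerProd_eq_pow, map_pow, h]
  simp

lemma map_intCast_injective :
    Function.Injective (PowerSeries.map (Int.castRingHom ℂ)) :=
  PowerSeries.map_injective _ Int.cast_injective

lemma constantCoeff_E4 : PowerSeries.constantCoeff E4 = 1 := by simp [E4]

lemma constantCoeff_E6 : PowerSeries.constantCoeff E6 = 1 := by simp [E6]

lemma exists_four_mul_add_six_mul {k : ℕ} (hk : Even k) (hk2 : k ≠ 2) :
    ∃ a b, 4 * a + 6 * b = k := by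
  obtain ⟨m, rfl⟩ := hk
  rcases Nat.even_or_odd' m with ⟨n, rfl | rfl⟩
  · exact ⟨n, 0, by ring⟩
  · exact ⟨n - 1, 1, by omega⟩

/-- **Sturm's bound** modulo `p` in level one. -/
theorem IsModFormMod.eq_zero {k : ℕ} {F : (ZMod p)⟦X⟧} (hF : IsModFormMod p k F)
    (h : PowerSeries.X ^ (k / 12 + 1) ∣ F) : F = 0 := by
  induction k using Nat.strong_induction_on generalizing F with | _ k ih =>
  obtain ⟨G, f, hG, rfl⟩ := hF
  have of_zero : ∀ {G : ℤ⟦X⟧} {f : ModularForm 𝒮ℒ k},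
      PowerSeries.map (Int.castRingHom ℂ) G = qExpansion 1 f → f = 0 → reduce p G = 0 := by
    rintro G f hG rfl
    rw [FunLike.coe_zero, qExpansion_zero] at hG
    rw [map_intCast_injective (hG.trans (map_zero _).symm), map_zero]
  rcases Nat.even_or_odd k with hk | hk
  swap
  · exact of_zero hG (levelOne_odd_weight_eq_zero (by exact_mod_cast hk) f)
  by_cases hk2 : k = 2
  · subst hk2
    exact of_zero hG (rank_zero_iff_forall_zero.mp levelOne_weight_two_rank_zero f)
  obtain ⟨a, b, hab⟩ := exists_four_mul_add_six_mul hk hk2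
  set c := PowerSeries.constantCoeff G with hc
  let e : ModularForm 𝒮ℒ k := ModularForm.mcast (by push_cast [← hab]; ring)
    ((E₄.pow a).mul (E₆.pow b))
  have he : PowerSeries.map (Int.castRingHom ℂ) (E4 ^ a * E6 ^ b) = qExpansion 1 e := by
    rw [ModularForm.qExpansion_mcast, ModularForm.qExpansion_mul one_pos one_mem_strictPeriods_SL,
      ModularForm.qExpansion_pow one_pos one_mem_strictPeriods_SL,
      ModularForm.qExpansion_pow one_pos one_mem_strictPeriods_SL, map_mul, map_pow, map_pow,
      map_E4, map_E6]
  have hcp : (c : ZMod p) = 0 := by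
    have : PowerSeries.X ∣ reduce p G := (dvd_pow_self _ (by omega)).trans h
    rw [PowerSeries.X_dvd_iff, ← PowerSeries.coeff_zero_eq_constantCoeff_apply,
      PowerSeries.coeff_map, PowerSeries.coeff_zero_eq_constantCoeff_apply, ← hc] at this
    exact this
  -- As p divides c and E₄ᵃE₆ᵇ has constant term 1, this changes nothing modulo p but makes the
  -- constant term vanish in characteristic zero.
  set G' := G - PowerSeries.C c * (E4 ^ a * E6 ^ b) with hG'
  set f' := f - (c : ℂ) • e with hf'
  have hGf' : PowerSeries.map (Int.castRingHom ℂ) G' = qExpansion 1 f' := by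
    rw [hG', hf', FunLike.coe_sub, ModularForm.qExpansion_sub one_pos one_mem_strictPeriods_SL,
      map_sub, hG, map_C_mul_eq_qExpansion c he]
  have hred : reduce p G' = reduce p G := by
    rw [hG', map_sub, map_mul, PowerSeries.map_C]
    simp [hcp]
  have hG0 : PowerSeries.constantCoeff G' = 0 := by
    simp [hG', constantCoeff_E4, constantCoeff_E6, hc]
  have hf0 : (qExpansion 1 f').coeff 0 = 0 := by
    rw [← hGf', PowerSeries.coeff_map, PowerSeries.coeff_zero_eq_constantCoeff_apply, hG0, map_zero]
  rw [← hred] at h ⊢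
  rcases lt_or_ge k 12 with hk12 | hk12
  · refine of_zero hGf' (sturm_bound_levelOne_nat ?_)
    rw [Nat.div_eq_of_lt hk12]
    refine lt_of_lt_of_le (b := ((1 : ℕ) : ℕ∞)) (by simp) (PowerSeries.nat_le_order _ _ ?_)
    rintro i hi
    rwa [Nat.lt_one_iff.mp hi]
  · obtain ⟨G₁, hG₁⟩ := PowerSeries.X_dvd_iff.mpr hG0
    -- Δ/q is a unit of ℤ⟦q⟧, so dividing by Δ keeps the coefficients integral. It lowers the weight
    -- by 12 and the order of vanishing by 1, just as the bound requires.
    obtain ⟨V, hV⟩ := exists_eulerProd_mul_eq_one 24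
    have hfac : G' = PowerSeries.X * eulerProd 24 * (V * G₁) := by
      rw [hG₁]; linear_combination (-PowerSeries.X * G₁) * hV
    have hq := qExpansion_eq_qExpansion_discriminant_mul f' hf0
    rw [← hGf', hfac, map_mul, map_X_mul_eulerProd] at hq
    have hΔ : qExpansion 1 ModularForm.discriminant ≠ 0 := fun h0 => by
      have := discriminant_qExpansion_order
      simp [h0] at this
    have hq' := mul_left_cancel₀ hΔ hq
    have hmod : IsModFormMod p ((k - 12 : ℕ) : ℤ) (reduce p (V * G₁)) :=
      (isModFormMod_reduce hq').congr_weight (by push_cast [hk12]; ring)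
    have hdvd : PowerSeries.X ^ ((k - 12) / 12 + 1) ∣ reduce p (V * G₁) := by
      obtain ⟨Q, hQ⟩ := h
      refine ⟨reduce p V * Q, ?_⟩
      have hV' : reduce p (eulerProd 24) * reduce p V = 1 := by rw [← map_mul, hV, map_one]
      rw [hfac, map_mul, map_mul, PowerSeries.map_X,
        show k / 12 + 1 = (k - 12) / 12 + 1 + 1 by omega, pow_succ', mul_assoc, mul_assoc] at hQ
      have hQ' := PowerSeries.X_mul_cancel hQ
      linear_combination (reduce p V) * hQ' - reduce p (V * G₁) * hV'
    rw [hfac, map_mul, ih (k - 12) (by omega) hmod hdvd, mul_zero]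

end ModularFormsModP

/-! ### Atkin's operator and its relation to θ. -/

section HeckeU

lemma theta_eq_X_mul_derivative {R : Type*} [CommRing R] (F : R⟦X⟧) :
    theta F = PowerSeries.X * PowerSeries.derivative R F := by
  ext n
  cases n with
  | zero => simp
  | succ n => rw [coeff_theta, PowerSeries.coeff_succ_X_mul, PowerSeries.coeff_derivative]
              push_cast
              ring

lemma theta_mul {R : Type*} [CommRing R] (F G : R⟦X⟧) :
    theta (F * G) = theta F * G + F * theta G := by
  simp only [theta_eq_X_mul_derivative, Derivation.leibniz, smul_eq_mul]
  ring

variable {p : ℕ} [hp : Fact p.Prime]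

instance : CharP (ZMod p)⟦X⟧ p :=
  charP_of_injective_ringHom (f := PowerSeries.C) PowerSeries.C_injective p

/-- Atkin's operator `U_p`: it sends `∑ a(n) qⁿ` to `∑ a(pn) qⁿ`. -/
noncomputable def atkinU (F : (ZMod p)⟦X⟧) : (ZMod p)⟦X⟧ :=
  PowerSeries.mk fun n => PowerSeries.coeff (p * n) F

@[simp]
lemma coeff_atkinU (F : (ZMod p)⟦X⟧) (n : ℕ) :
    PowerSeries.coeff n (atkinU F) = PowerSeries.coeff (p * n) F :=
  PowerSeries.coeff_mk _ _

lemma expand_eq_pow (F : (ZMod p)⟦X⟧) : PowerSeries.expand p hp.out.ne_zero F = F ^ p := by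
  have h := MvPowerSeries.map_frobenius_expand (R := ZMod p) p hp.out.ne_zero (f := F)
  rw [ZMod.frobenius_zmod, MvPowerSeries.map_id] at h
  exact h

lemma coeff_pow_prime (F : (ZMod p)⟦X⟧) (n : ℕ) :
    PowerSeries.coeff n (F ^ p) = if p ∣ n then PowerSeries.coeff (n / p) F else 0 := by
  rw [← expand_eq_pow, PowerSeries.coeff_expand]

lemma theta_pow_prime (F : (ZMod p)⟦X⟧) : theta (F ^ p) = 0 := by
  rw [theta_eq_X_mul_derivative, PowerSeries.derivative_pow]
  simp [CharP.cast_eq_zero]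

lemma iterate_theta_mul_pow_prime (F H : (ZMod p)⟦X⟧) (m : ℕ) :
    theta^[m] (F * H ^ p) = theta^[m] F * H ^ p := by
  induction m with
  | zero => rfl
  | succ m ih => rw [Function.iterate_succ_apply', ih, theta_mul, theta_pow_prime,
      Function.iterate_succ_apply', mul_zero, add_zero]

/-- By Fermat, θᵖ⁻¹ removes exactly the terms with p ∣ n. Those terms form (UF)(qᵖ), which is (UF)ᵖ
over 𝔽ₚ. -/
lemma sub_iterate_theta (F : (ZMod p)⟦X⟧) : F - theta^[p - 1] F = atkinU F ^ p := by
  ext n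
  rw [map_sub, coeff_iterate_theta, coeff_pow_prime]
  have hp1 : p - 1 ≠ 0 := by have := hp.out.two_le; omega
  split_ifs with h
  · rw [(ZMod.natCast_eq_zero_iff n p).mpr h, zero_pow hp1, coeff_atkinU, Nat.mul_div_cancel' h]
    ring
  · have : (n : ZMod p) ≠ 0 := mt (ZMod.natCast_eq_zero_iff n p).mp h
    rw [ZMod.pow_card_sub_one_eq_one this]
    ring

lemma pow_prime_injective : Function.Injective fun F : (ZMod p)⟦X⟧ => F ^ p := by
  intro F G h
  have h' : (F - G) ^ p = 0 := by rw [sub_pow_char, sub_eq_zero]; exact h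
  exact sub_eq_zero.mp (pow_eq_zero_iff hp.out.ne_zero |>.mp h')

/-- θ kills p-th powers, hence 1 - θᵖ⁻¹ commutes with multiplication by Hᵖ; then take p-th roots. -/
lemma atkinU_mul_pow_prime (F H : (ZMod p)⟦X⟧) : atkinU (F * H ^ p) = atkinU F * H := by
  refine pow_prime_injective ?_
  beta_reduce
  rw [← sub_iterate_theta, iterate_theta_mul_pow_prime, mul_pow, ← sub_iterate_theta]
  ring

end HeckeU

/-! ### Weights modulo 23: E₂₂ ≡ 1, E₂₄ ≡ E₂, and θ. -/

section Eisenstein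

lemma sigma_modEq (p : ℕ) [Fact p.Prime] (k n : ℕ) (hk : k ≠ 0) :
    (ArithmeticFunction.sigma (k + (p - 1)) n : ZMod p) = ArithmeticFunction.sigma k n := by
  have hp := (Fact.out : p.Prime).two_le
  simp only [ArithmeticFunction.sigma_apply, Nat.cast_sum, Nat.cast_pow]
  refine Finset.sum_congr rfl fun d _ => ?_
  obtain ⟨k, rfl⟩ := Nat.exists_eq_succ_of_ne_zero hk
  rw [show k.succ + (p - 1) = k + p by omega, pow_add, ZMod.pow_card, pow_succ]

instance fact_prime_twentyThree : Fact (Nat.Prime 23) := ⟨by norm_num⟩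

lemma isModFormMod_one : IsModFormMod 23 22 1 := by
  -- 44/B₂₂ = 6072/854513 and 23 ∣ 6072, so only the constant term survives; 19 inverts 854513
  -- modulo 23.
  have h := (isModFormMod_eisenstein (p := 23) (k := 22) (N := 854513) (D := 6072) (by norm_num)
    (by decide) (by norm_num) (by rw [bernoulli_twentyTwo]; norm_num)).C_mul 19
  convert! h using 1
  rw [map_sub, map_mul, PowerSeries.map_C, PowerSeries.map_C, Int.coe_castRingHom]
  beta_reduce
  rw [show ((6072 : ℤ) : ZMod 23) = 0 by decide, map_zero, zero_mul, sub_zero, ← map_mul,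
    show (19 * ((854513 : ℤ) : ZMod 23)) = 1 by decide, map_one]

lemma isModFormMod_E2 : IsModFormMod 23 24 (reduce 23 E2) := by
  -- 48/B₂₄ = -131040/236364091, and 5 inverts 236364091 modulo 23.
  have h := (isModFormMod_eisenstein (p := 23) (k := 24) (N := 236364091) (D := -131040)
    (by norm_num) (by decide) (by norm_num) (by rw [bernoulli_twentyFour]; norm_num)).C_mul 5
  convert! h using 1
  ext n
  simp only [map_sub, map_mul, PowerSeries.map_C, PowerSeries.coeff_map, PowerSeries.coeff_C_mul,
    coeff_E2, PowerSeries.coeff_C, PowerSeries.coeff_mk, Int.coe_castRingHom]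
  split_ifs with hn
  · simp only [hn, ArithmeticFunction.map_zero, Nat.cast_zero, Int.cast_zero, mul_zero, sub_zero]
    decide
  · have hs := sigma_modEq 23 1 n one_ne_zero
    have hc : (-24 : ZMod 23) = 5 * 131040 := by decide
    norm_num at hs ⊢
    rw [hs]
    linear_combination (ArithmeticFunction.sigma 1 n : ZMod 23) * hc

variable {k : ℤ} {F : (ZMod 23)⟦X⟧}

lemma IsModFormMod.mul_weight (hF : IsModFormMod 23 k F) (n : ℕ) :
    IsModFormMod 23 (k + 22 * n) F := by
  have h := hF.mul (isModFormMod_one.pow n)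
  rw [one_pow, mul_one] at h
  exact h.congr_weight (by ring)

/-- 12θF is the scaled Serre derivative, raised from weight k + 2 by E₂₂ ≡ 1, plus k·E₂₄F; and 2 is
the inverse of 12. -/
lemma IsModFormMod.theta (hF : IsModFormMod 23 k F) : IsModFormMod 23 (k + 24) (theta F) := by
  have h1 := (hF.serre.mul_weight 1).congr_weight (show k + 2 + 22 * (1 : ℕ) = k + 24 by ring)
  have h2 := ((isModFormMod_E2.mul hF).C_mul (k : ZMod 23)).congr_weight (add_comm 24 k)
  have h := (h1.add h2).C_mul 2
  rw [sub_add_cancel, ← mul_assoc, ← map_mul, show (2 * 12 : ZMod 23) = 1 by decide, map_one,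
    one_mul] at h
  exact h

lemma IsModFormMod.iterate_theta (hF : IsModFormMod 23 k F) (m : ℕ) :
    IsModFormMod 23 (k + 24 * m) (PartitionMod23.theta^[m] F) := by
  induction m with
  | zero => exact hF.congr_weight (by simp)
  | succ m ih =>
    rw [Function.iterate_succ_apply']
    exact ih.theta.congr_weight (by push_cast; ring)

/-- The image under `U₂₃` of a modular form modulo 23 is determined by finitely many
coefficients. -/
theorem atkinU_eq_of_dvd {k l b m : ℕ} {F H : (ZMod 23)⟦X⟧} (hF : IsModFormMod 23 k F)
    (hH : IsModFormMod 23 l H) (hkl : k + 528 = 23 * l + 22 * b) (hm : (k + 528) / 12 < 23 * m)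
    (h : PowerSeries.X ^ m ∣ atkinU F - H) : atkinU F = H := by
  -- The 22 applications of θ add 22 · 24 = 528 to the weight; powers of E₂₂ ≡ 1 bring F and H²³ to
  -- the same weight.
  have h1 : IsModFormMod 23 ((k + 528 : ℕ) : ℤ) ((atkinU F - H) ^ 23) := by
    rw [sub_pow_char, ← sub_iterate_theta]
    refine ((hF.mul_weight 24).congr_weight (by push_cast; ring)).sub
      ((hF.iterate_theta 22).congr_weight (by push_cast; ring)) |>.sub ?_
    refine ((hH.pow 23).mul_weight b).congr_weight ?_
    push_cast
    exact_mod_cast hkl.symm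
  have h2 := h1.eq_zero (((pow_dvd_pow _ (by omega)).trans (pow_mul _ m 23).dvd).trans
    (pow_dvd_pow_of_dvd h 23))
  exact sub_eq_zero.mp (pow_eq_zero_iff (by norm_num) |>.mp h2)

end Eisenstein

/-! ### Explicit coefficients of E₄E₆, E, p and g. -/

section Expansions

open UpperHalfPlane hiding I
open ModularForm
open scoped MatrixGroups

/-- E₄E₆ = E₁₀: both have weight 10 and constant term 1, and in this weight the constant term
determines the form. -/
lemma coeff_E4_mul_E6 (n : ℕ) : PowerSeries.coeff n (E4 * E6) =
    if n = 0 then 1 else -264 * (ArithmeticFunction.sigma 9 n : ℤ) := by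
  let e : ModularForm 𝒮ℒ (10 : ℕ) := ModularForm.mcast (by norm_num) (E₄.mul E₆)
  let E₁₀ : ModularForm 𝒮ℒ (10 : ℕ) := E (by norm_num : 3 ≤ 10)
  have he : qExpansion 1 e = PowerSeries.map (Int.castRingHom ℂ) (E4 * E6) := by
    rw [ModularForm.qExpansion_mcast, ModularForm.qExpansion_mul one_pos one_mem_strictPeriods_SL,
      map_mul, map_E4, map_E6]
  have hE₁₀ := EisensteinSeries.E_qExpansion_coeff (k := 10) (by norm_num) (by decide)
  have hzero : e - E₁₀ = 0 := by
    refine sturm_bound_levelOne_nat (lt_of_lt_of_le (b := ((1 : ℕ) : ℕ∞)) (by simp)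
      (PowerSeries.nat_le_order _ _ ?_))
    intro i hi
    rw [FunLike.coe_sub, ModularForm.qExpansion_sub one_pos one_mem_strictPeriods_SL, map_sub, he,
      Nat.lt_one_iff.mp hi, hE₁₀, PowerSeries.coeff_map, PowerSeries.coeff_zero_eq_constantCoeff,
      map_mul, constantCoeff_E4, constantCoeff_E6]
    simp
  have h := hE₁₀ n
  rw [show E (by norm_num : 3 ≤ 10) = e from (sub_eq_zero.mp hzero).symm, he,
    PowerSeries.coeff_map, bernoulli_ten] at h
  have hinj : Function.Injective ((↑) : ℤ → ℂ) := Int.cast_injective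
  refine hinj (h.trans ?_)
  split_ifs <;> norm_num

/-- The coefficients of `∏_{n ≥ 1} (1 - qⁿ)` below `q²⁵`. -/
noncomputable def eulerCoeff (n : ℕ) : ℤ :=
  ∑ k ∈ Finset.Icc (-4 : ℤ) 4, if pentagonal k = n then (-1) ^ k.natAbs else 0

lemma coeff_pentagonalSeries_eq_eulerCoeff {n : ℕ} (hn : n < 25) :
    PowerSeries.coeff n (PowerSeries.pentagonalSeries ℤ) = eulerCoeff n := by
  by_cases h : ∃ k, pentagonal k = n
  · obtain ⟨k, rfl⟩ := h
    have hk := two_mul_natCast_pentagonal k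
    have hk1 : k ≤ 4 := by by_contra!; nlinarith
    have hk2 : -4 ≤ k := by by_contra!; nlinarith
    simp [eulerCoeff, hk1, hk2, Int.coe_negOnePow ℤ]
  · rw [PowerSeries.coeff_pentagonalSeries_eq_zero _ (by simpa using h), eulerCoeff]
    push Not at h
    simp [h]

/-- The generating function of the partition numbers. -/
noncomputable def partitionSeries : ℤ⟦X⟧ := PowerSeries.mk fun n => (p n : ℤ)

lemma partitionSeries_mul_pentagonalSeries :
    partitionSeries * PowerSeries.pentagonalSeries ℤ = 1 := by
  have h1 := Nat.Partition.hasProd_powerSeriesMk_card_restricted ℤ fun _ => True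
  have h2 := h1.mul (PowerSeries.WithPiTopology.hasProd_one_sub_X_pow ℤ)
  have h3 : (PowerSeries.mk fun n => ((Nat.Partition.restricted n fun _ => True).card : ℤ)) =
      partitionSeries := by
    ext n
    simp [partitionSeries, p, Nat.Partition.restricted]
  rw [h3] at h2
  refine h2.unique ?_
  convert! hasProd_one (α := ℤ⟦X⟧) (β := ℕ) using 2 with i
  simp only [if_true, pow_mul]
  exact PowerSeries.WithPiTopology.tsum_pow_mul_one_sub_of_constantCoeff_eq_zero (by simp)

/-- The partition numbers below `25`. -/
def partitionTable (n : ℕ) : ℤ :=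
  [1, 1, 2, 3, 5, 7, 11, 15, 22, 30, 42, 56, 77, 101, 135, 176, 231, 297, 385, 490, 627, 792, 1002,
    1255, 1575].getD n 0

lemma p_eq_partitionTable {n : ℕ} (hn : n < 25) : (p n : ℤ) = partitionTable n := by
  set Q : ℤ⟦X⟧ := PowerSeries.mk partitionTable
  have hQ : PowerSeries.X ^ 25 ∣ PowerSeries.pentagonalSeries ℤ * Q - 1 := by
    rw [PowerSeries.X_pow_dvd_iff]
    intro m hm
    rw [map_sub, PowerSeries.coeff_mul, Finset.sum_congr rfl
      (g := fun i => eulerCoeff i.1 * partitionTable i.2) fun i hi => by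
        rw [coeff_pentagonalSeries_eq_eulerCoeff
          (by have := Finset.HasAntidiagonal.mem_antidiagonal.mp hi; omega), PowerSeries.coeff_mk],
      PowerSeries.coeff_one]
    revert m
    decide +kernel
  have h : PowerSeries.X ^ 25 ∣ Q - partitionSeries := by
    convert! hQ.mul_left partitionSeries using 1
    linear_combination (-Q) * partitionSeries_mul_pentagonalSeries
  have := PowerSeries.X_pow_dvd_iff.mp h n hn
  rw [map_sub, PowerSeries.coeff_mk, partitionSeries, PowerSeries.coeff_mk] at this
  linarith

lemma g_eq_sum {n : ℕ} (hn : n < 25) : g n =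
    ∑ i ∈ Finset.HasAntidiagonal.antidiagonal n, eulerCoeff i.1 *
      if i.2 = 0 then 1 else -264 * (ArithmeticFunction.sigma 9 i.2 : ℤ) := by
  rw [g, eulerProd_eq_pow, pow_one, mul_comm, PowerSeries.coeff_mul]
  refine Finset.sum_congr rfl fun i hi => ?_
  have hin : i.1 < 25 := by have := Finset.HasAntidiagonal.mem_antidiagonal.mp hi; omega
  rw [coeff_pentagonalSeries_eq_eulerCoeff hin, coeff_E4_mul_E6]

lemma g_zero : g 0 = 1 := by
  rw [g_eq_sum (by norm_num)]
  decide +kernel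

lemma g_one : g 1 = -265 := by
  rw [g_eq_sum (by norm_num)]
  decide +kernel

lemma g_twentyTwo : (g 22 : ZMod 23) = 5 := by
  rw [show (5 : ZMod 23) = ((5 : ℤ) : ZMod 23) by norm_num, ZMod.intCast_eq_intCast_iff,
    g_eq_sum (by norm_num)]
  decide +kernel

end Expansions

/-! ### The three congruences modulo 23 and the induction. -/

section Congruences

local notation "𝔼" => PowerSeries.pentagonalSeries (ZMod 23)
local notation "𝔾" => reduce 23 (E4 * E6)

lemma coeff_eulerProd_one_mul (n : ℕ) : (g n : ZMod 23) = PowerSeries.coeff n (𝔼 * 𝔾) := by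
  rw [g, eulerProd_eq_pow, pow_one, ← map_pentagonalSeries (Int.castRingHom (ZMod 23)), ← map_mul,
    PowerSeries.coeff_map, mul_comm]
  rfl

lemma coeff_eulerProd_twentyThree_mul (n : ℕ) :
    (h n : ZMod 23) = PowerSeries.coeff n (𝔼 ^ 23 * 𝔾) := by
  rw [h, eulerProd_eq_pow, ← map_pentagonalSeries (Int.castRingHom (ZMod 23)), ← map_pow, ← map_mul,
    PowerSeries.coeff_map, mul_comm]
  rfl

lemma isModFormMod_X_mul_pow : IsModFormMod 23 12 (PowerSeries.X * 𝔼 ^ 24) := by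
  have h := isModFormMod_discriminant (p := 23)
  rwa [map_mul, PowerSeries.map_X, eulerProd_eq_pow, map_pow, map_pentagonalSeries] at h

lemma isModFormMod_X_mul_pow_mul :
    IsModFormMod 23 22 (PowerSeries.X * 𝔼 ^ 24 * 𝔾) := by
  rw [map_mul]
  exact isModFormMod_X_mul_pow.mul
    ((isModFormMod_reduce map_E4).mul (isModFormMod_reduce map_E6))

lemma pentagonalSeries_ne_zero : 𝔼 ≠ 0 := fun h0 => by
  have h1 := PowerSeries.coeff_pentagonalSeries_pentagonal (ZMod 23) 0
  simp [h0] at h1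

lemma atkinU_pow_mul_partitionSeries :
    atkinU (PowerSeries.X ^ 22 * reduce 23 partitionSeries) =
      PowerSeries.X * PowerSeries.mk fun n => (p (23 * n + 1) : ZMod 23) := by
  ext n
  rw [coeff_atkinU, PowerSeries.coeff_X_pow_mul']
  cases n with
  | zero => simp
  | succ n =>
    rw [if_pos (by omega), PowerSeries.coeff_succ_X_mul, PowerSeries.coeff_mk,
      PowerSeries.coeff_map, partitionSeries, PowerSeries.coeff_mk,
      show 23 * (n + 1) - 22 = 23 * n + 1 by omega]
    simp

/-- The generating function of `p(23n + 1)` modulo 23. -/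
lemma mk_p_eq :
    (PowerSeries.mk fun n => (p (23 * n + 1) : ZMod 23)) = 𝔼 * 𝔾 := by
  set A : (ZMod 23)⟦X⟧ := PowerSeries.mk fun n => (p (23 * n + 1) : ZMod 23) with hA
  have hP : reduce 23 partitionSeries * 𝔼 = 1 := by
    rw [← map_pentagonalSeries (Int.castRingHom (ZMod 23)), ← map_mul,
      partitionSeries_mul_pentagonalSeries, map_one]
  -- 24 · 22 = 23² - 1, so 𝔼⁵²⁸ = 𝔼⁻¹ · (𝔼²³)²³, and 𝔼⁻¹ generates the partition numbers.
  have hF : (PowerSeries.X * 𝔼 ^ 24) ^ 22 =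
      PowerSeries.X ^ 22 * reduce 23 partitionSeries * (𝔼 ^ 23) ^ 23 := by
    linear_combination (-PowerSeries.X ^ 22 * 𝔼 ^ 528) * hP
  have hU : atkinU ((PowerSeries.X * 𝔼 ^ 24) ^ 22) = PowerSeries.X * A * 𝔼 ^ 23 := by
    rw [hF, atkinU_mul_pow_prime, atkinU_pow_mul_partitionSeries]
  have hdvd : PowerSeries.X ^ 2 ∣ A - 𝔼 * 𝔾 := by
    rw [PowerSeries.X_pow_dvd_iff]
    intro m hm
    rw [map_sub, ← coeff_eulerProd_one_mul, hA, PowerSeries.coeff_mk]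
    have h1 : ((p 1 : ℤ) : ZMod 23) = 1 := by
      rw [p_eq_partitionTable (by norm_num)]; decide
    have h24 : ((p 24 : ℤ) : ZMod 23) = 1575 := by
      rw [p_eq_partitionTable (by norm_num)]; decide
    interval_cases m
    · rw [g_zero, ← Int.cast_natCast, mul_zero, zero_add, h1]
      decide
    · rw [g_one, ← Int.cast_natCast, show 23 * 1 + 1 = 24 from rfl, h24]
      decide
  -- The common weight is 264 + 528 = 792 = 23 · 22 + 22 · 13, and 792/12 = 66 < 23 · 3. The factor
  -- q leaves just p(1) and p(24) to compare.
  have hmain := atkinU_eq_of_dvd (k := 264) (l := 22) (b := 13) (m := 3)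
    ((isModFormMod_X_mul_pow.pow 22).congr_weight (by norm_num)) isModFormMod_X_mul_pow_mul
    (by norm_num) (by norm_num) (by
      rw [hU]
      obtain ⟨Q, hQ⟩ := hdvd
      exact ⟨𝔼 ^ 23 * Q, by linear_combination (PowerSeries.X * 𝔼 ^ 23) * hQ⟩)
  rw [hU] at hmain
  refine mul_left_cancel₀ (mul_ne_zero PowerSeries.X_ne_zero
    (pow_ne_zero 23 pentagonalSeries_ne_zero)) ?_
  linear_combination hmain

lemma atkinU_X_mul :
    atkinU (PowerSeries.X * (𝔼 * 𝔾)) =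
      PowerSeries.X * PowerSeries.mk fun n => (g (23 * n + 22) : ZMod 23) := by
  ext n
  rw [coeff_atkinU]
  cases n with
  | zero => simp
  | succ n =>
    rw [show 23 * (n + 1) = 23 * n + 22 + 1 by ring, PowerSeries.coeff_succ_X_mul,
      PowerSeries.coeff_succ_X_mul, PowerSeries.coeff_mk, coeff_eulerProd_one_mul]

/-- The generating function of `g(23n + 22)` modulo 23. -/
lemma mk_g_eq :
    (PowerSeries.mk fun n => (g (23 * n + 22) : ZMod 23)) =
      PowerSeries.C 5 * (𝔼 ^ 23 * 𝔾) := by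
  set B : (ZMod 23)⟦X⟧ := PowerSeries.mk fun n => (g (23 * n + 22) : ZMod 23) with hB
  have hU : atkinU (PowerSeries.X * 𝔼 ^ 24 * 𝔾) = PowerSeries.X * B * 𝔼 := by
    rw [show PowerSeries.X * 𝔼 ^ 24 * 𝔾 = PowerSeries.X * (𝔼 * 𝔾) * 𝔼 ^ 23 by ring,
      atkinU_mul_pow_prime, atkinU_X_mul]
  have hdvd : PowerSeries.X ∣ B - PowerSeries.C 5 * (𝔼 ^ 23 * 𝔾) := by
    have hE : PowerSeries.constantCoeff 𝔼 = 1 := by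
      simpa [show pentagonal 0 = 0 by decide] using
        PowerSeries.coeff_pentagonalSeries_pentagonal (ZMod 23) 0
    have hEG : PowerSeries.constantCoeff (𝔼 * 𝔾) = 1 := by
      rw [← PowerSeries.coeff_zero_eq_constantCoeff_apply, ← coeff_eulerProd_one_mul, g_zero,
        Int.cast_one]
    have hB0 : PowerSeries.constantCoeff B = 5 := by
      rw [← PowerSeries.coeff_zero_eq_constantCoeff_apply, hB, PowerSeries.coeff_mk, ← g_twentyTwo]
    rw [PowerSeries.X_dvd_iff, show 𝔼 ^ 23 * 𝔾 = 𝔼 * 𝔾 * 𝔼 ^ 22 by ring, map_sub, map_mul,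
      map_mul _ (𝔼 * 𝔾), map_pow, hE, hEG, hB0, PowerSeries.constantCoeff_C, one_pow, mul_one,
      mul_one, sub_self]
  -- The weight is 550 and ⌊550/12⌋ = 45 < 23 · 2, so g(22) ≡ 5 is the only coefficient needed.
  have hmain := atkinU_eq_of_dvd (k := 22) (l := 22) (b := 2) (m := 2)
    isModFormMod_X_mul_pow_mul (isModFormMod_X_mul_pow_mul.C_mul 5) (by norm_num) (by norm_num) (by
      rw [hU]
      obtain ⟨Q, hQ⟩ := hdvd
      exact ⟨𝔼 * Q, by linear_combination (PowerSeries.X * 𝔼) * hQ⟩)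
  rw [hU] at hmain
  refine mul_left_cancel₀ (mul_ne_zero PowerSeries.X_ne_zero pentagonalSeries_ne_zero) ?_
  linear_combination hmain

lemma atkinU_E4_mul_E6 : atkinU 𝔾 = 𝔾 := by
  ext n
  rw [coeff_atkinU, PowerSeries.coeff_map, PowerSeries.coeff_map, coeff_E4_mul_E6, coeff_E4_mul_E6]
  rcases eq_or_ne n 0 with rfl | hn
  · simp
  rw [if_neg (by omega), if_neg hn]
  have hs : (ArithmeticFunction.sigma 9 (23 * n) : ZMod 23) = ArithmeticFunction.sigma 9 n := by
    simp only [ArithmeticFunction.sigma_apply, Nat.cast_sum, Nat.cast_pow]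
    symm
    -- A divisor of 23n that does not divide n is a multiple of 23, so its ninth power vanishes
    -- modulo 23.
    refine Finset.sum_subset (Nat.divisors_subset_of_dvd (by omega) (dvd_mul_left n 23)) ?_
    intro d hd hd'
    have hd1 : d ∣ 23 * n := Nat.dvd_of_mem_divisors hd
    have hd2 : 23 ∣ d := by
      by_contra h23
      have hcop : Nat.Coprime d 23 := ((Nat.Prime.coprime_iff_not_dvd (by norm_num)).mpr h23).symm
      exact hd' (Nat.mem_divisors.mpr ⟨hcop.dvd_of_dvd_mul_left hd1, hn⟩)
    rw [(ZMod.natCast_eq_zero_iff d 23).mpr hd2, zero_pow (by norm_num)]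
  simp [hs]

lemma p_modEq (n : ℕ) : (p (23 * n + 1) : ZMod 23) = g n := by
  rw [coeff_eulerProd_one_mul, ← mk_p_eq, PowerSeries.coeff_mk]

lemma g_modEq (n : ℕ) : (g (23 * n + 22) : ZMod 23) = 5 * h n := by
  rw [coeff_eulerProd_twentyThree_mul, ← PowerSeries.coeff_C_mul, ← mk_g_eq, PowerSeries.coeff_mk]

lemma h_modEq (n : ℕ) : (h (23 * n) : ZMod 23) = g n := by
  rw [coeff_eulerProd_one_mul, coeff_eulerProd_twentyThree_mul, ← coeff_atkinU, mul_comm,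
    atkinU_mul_pow_prime, atkinU_E4_mul_E6, mul_comm]

lemma exists_pow_odd_mul (k n : ℕ) : ∃ a, 23 ^ (2 * k + 1) * (24 * n + 1) + 1 = 24 * a ∧
    (p a : ZMod 23) = 5 ^ k * g n := by
  induction k generalizing n with
  | zero => exact ⟨23 * n + 1, by ring, by rw [p_modEq]; simp⟩
  | succ k ih =>
    -- 24(23²n + 22) + 1 = 23²(24n + 1), so the argument of p is unchanged.
    obtain ⟨a, ha, hpa⟩ := ih (23 * (23 * n) + 22)
    refine ⟨a, by rw [← ha]; ring, ?_⟩
    rw [hpa, g_modEq, h_modEq]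
    ring

lemma exists_pow_even_mul (k n : ℕ) : ∃ a, 23 ^ (2 * k + 2) * (24 * n + 23) + 1 = 24 * a ∧
    (p a : ZMod 23) = 5 ^ (k + 1) * h n := by
  -- 24(23n + 22) + 1 = 23(24n + 23).
  obtain ⟨a, ha, hpa⟩ := exists_pow_odd_mul k (23 * n + 22)
  refine ⟨a, by rw [← ha]; ring, ?_⟩
  rw [hpa, g_modEq]
  ring

end Congruences

end PartitionMod23

theorem corollary12 :
    (∀ k n : ℕ,
      24 ∣ 23 ^ (2 * k + 1) * (24 * n + 1) + 1 ∧
      (PartitionMod23.p ((23 ^ (2 * k + 1) * (24 * n + 1) + 1) / 24) : ℤ) ≡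
        5 ^ k * PartitionMod23.g n [ZMOD 23]) ∧
    (∀ k n : ℕ,
      24 ∣ 23 ^ (2 * k + 2) * (24 * n + 23) + 1 ∧
      (PartitionMod23.p ((23 ^ (2 * k + 2) * (24 * n + 23) + 1) / 24) : ℤ) ≡
        5 ^ (k + 1) * PartitionMod23.h n [ZMOD 23]) ∧
    (∀ k : ℕ,
      24 ∣ 23 ^ (2 * k + 1) + 1 ∧
      (PartitionMod23.p ((23 ^ (2 * k + 1) + 1) / 24) : ℤ) ≡ 5 ^ k [ZMOD 23]) := by
  have hodd : ∀ k n : ℕ, 24 ∣ 23 ^ (2 * k + 1) * (24 * n + 1) + 1 ∧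
      (PartitionMod23.p ((23 ^ (2 * k + 1) * (24 * n + 1) + 1) / 24) : ℤ) ≡
        5 ^ k * PartitionMod23.g n [ZMOD 23] := by
    intro k n
    obtain ⟨a, ha, hp⟩ := PartitionMod23.exists_pow_odd_mul k n
    rw [ha, Nat.mul_div_cancel_left a (by norm_num)]
    refine ⟨dvd_mul_right 24 a, (ZMod.intCast_eq_intCast_iff _ _ 23).mp ?_⟩
    push_cast
    exact hp
  refine ⟨hodd, fun k n => ?_, fun k => ?_⟩
  · obtain ⟨a, ha, hp⟩ := PartitionMod23.exists_pow_even_mul k n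
    rw [ha, Nat.mul_div_cancel_left a (by norm_num)]
    refine ⟨dvd_mul_right 24 a, (ZMod.intCast_eq_intCast_iff _ _ 23).mp ?_⟩
    push_cast
    exact hp
  · simpa [PartitionMod23.g_zero] using hodd k 0
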